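/- All vector spaces are real. A vector lattice $X$ is Archimedean if $x,y\ge 0$ and $kx\le y$ for all $k\in\mathbb{N}$ imply $x=0$. For $n\ge 1$ let $H_n$ be the vector lattice (with pointwise operations and order) of all continuous functions $f\colon\mathbb{R}^n\to\mathbb{R}$ that are positively homogeneous, i.e. $f(\lambda t)=\lambda f(t)$ for all $\lambda\ge 0$ and $t\in\mathbb{R}^n$, and let $\pi_i\in H_n$ be the $i$-th coordinate projection. A vector lattice homomorphism is a linear map that preserves finite suprema and infima. For $e\ge 0$ in $X$ let $I_e=\{y\in X: |y|\le\lambda e \text{ for some }\lambda\ge 0\}$ be the order ideal generated by $e$, with $\|y\|_e=\inf\{\lambda\ge 0: |y|\le\lambda e\}$ for $y\in I_e$; if $X$ is Archimedean, $\|\cdot\|_e$ is a norm on $I_e$. The closed sublattice of $(I_e,\|\cdot\|_e)$ generated by a set is the smallest $\|\cdot\|_e$-closed linear sublattice of $I_e$ containing it. **Proposition.** Let $X$ be an Archimedean vector lattice, $n\ge 1$, and $(x_1,\dots,x_n)\in X^n$. The following three conditions are equivalent: (a) there is a vector lattice homomorphism $\Phi\colon H_n\to X$ with $\Phi(\pi_i)=x_i$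 for $i=1,\dots,n$; (b) for $e=|x_1|\vee\cdots\vee|x_n|$, the norm $\|\cdot\|_e$ is complete on the closed sublattice of $(I_e,\|\cdot\|_e)$ generated by $x_1,\dots,x_n$; (c) there is a positive element $e\in X$ with $e\ge|x_1|\vee\cdots\vee|x_n|$ such that the norm $\|\cdot\|_e$ is complete on the closed sublattice of $(I_e,\|\cdot\|_e)$ generated by $x_1,\dots,x_n$. When these conditions are satisfied, the vector lattice homomorphism $\Phi\colon H_n\to X$ with $\Phi(\pi_i)=x_i$ for $i=1,\dots,n$ is unique. -/

import Mathlib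

/-!
A (real) vector lattice is a real vector space `X` with a lattice order for which translations and
multiplication by non-negative scalars are monotone, that is,
`[AddCommGroup X] [Lattice X] [IsOrderedAddMonoid X] [Module ℝ X] [IsOrderedModule ℝ X]`.
-/

namespace VL

/-- `X` is Archimedean: if `x, y ≥ 0` and `n x ≤ y` for all natural numbers `n`, then `x = 0`.
(Mathlib's class `Archimedean` is a different, stronger notion for orders that are not linear.) -/
def IsArchimedean (X : Type*) [AddCommGroup X] [Lattice X] : Prop :=
  ∀ x y : X, 0 ≤ x → 0 ≤ y → (∀ n : ℕ, n • x ≤ y) → x = 0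

/-- A vector lattice homomorphism: a linear map that preserves `⊔` and `⊓`. -/
structure VectorLatticeHom (E F : Type*) [AddCommGroup E] [Lattice E] [Module ℝ E]
    [AddCommGroup F] [Lattice F] [Module ℝ F] extends E →ₗ[ℝ] F, LatticeHom E F

instance {E F : Type*} [AddCommGroup E] [Lattice E] [Module ℝ E]
    [AddCommGroup F] [Lattice F] [Module ℝ F] : CoeFun (VectorLatticeHom E F) (fun _ => E → F) :=
  ⟨fun Φ => Φ.toFun⟩

/-- The positively homogeneous, continuous, real-valued functions on `ℝⁿ`, as a linear subspace of
`C(ℝⁿ, ℝ)`; the order and the lattice operations below are those of `C(ℝⁿ, ℝ)`, pointwise. -/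
def H (n : ℕ) : Submodule ℝ C(Fin n → ℝ, ℝ) where
  carrier := {f | ∀ (r : ℝ) (t : Fin n → ℝ), 0 ≤ r → f (r • t) = r * f t}
  add_mem' := by
    intro f g hf hg r t hr
    simp only [ContinuousMap.add_apply]
    rw [hf r t hr, hg r t hr, mul_add]
  zero_mem' := by
    intro r t hr
    simp
  smul_mem' := by
    intro c f hf r t hr
    simp only [ContinuousMap.smul_apply, smul_eq_mul]
    rw [hf r t hr, mul_left_comm]

theorem H.sup_mem {n : ℕ} {f g : C(Fin n → ℝ, ℝ)} (hf : f ∈ H n) (hg : g ∈ H n) :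
    f ⊔ g ∈ H n := by
  intro r t hr
  simp only [ContinuousMap.sup_apply]
  rw [hf r t hr, hg r t hr, mul_max_of_nonneg _ _ hr]

theorem H.inf_mem {n : ℕ} {f g : C(Fin n → ℝ, ℝ)} (hf : f ∈ H n) (hg : g ∈ H n) :
    f ⊓ g ∈ H n := by
  intro r t hr
  simp only [ContinuousMap.inf_apply]
  rw [hf r t hr, hg r t hr, mul_min_of_nonneg _ _ hr]

instance (n : ℕ) : Lattice (H n) :=
  Subtype.lattice (fun _ _ hf hg => H.sup_mem hf hg) (fun _ _ hf hg => H.inf_mem hf hg)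

/-- The `i`-th coordinate projection, as an element of `H n`. -/
def proj {n : ℕ} (i : Fin n) : H n :=
  ⟨⟨fun t => t i, continuous_apply i⟩, fun r t _ => by simp⟩

section VectorLattice

set_option linter.unusedSectionVars false

variable {X : Type*} [AddCommGroup X] [Lattice X] [IsOrderedAddMonoid X] [Module ℝ X]
  [IsOrderedModule ℝ X]

theorem abs_smul_le (c : ℝ) (x : X) : |c • x| ≤ |c| • |x| := by
  have key : ∀ (c : ℝ) (x : X), c • x ≤ |c| • |x| := by
    intro c x
    rcases le_total 0 c with hc | hc
    · rw [abs_of_nonneg hc]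
      exact smul_le_smul_of_nonneg_left (le_abs_self x) hc
    · rw [abs_of_nonpos hc, ← neg_smul_neg c x]
      exact smul_le_smul_of_nonneg_left (neg_le_abs x) (neg_nonneg.2 hc)
  refine abs_le'.2 ⟨key c x, ?_⟩
  rw [← neg_smul]
  simpa using key (-c) x

/-- The order ideal `I_e` generated by `e`. -/
def orderIdeal (e : X) : Submodule ℝ X where
  carrier := {x | ∃ r : ℝ, 0 ≤ r ∧ |x| ≤ r • e}
  add_mem' := by
    rintro x y ⟨r, hr, hx⟩ ⟨s, hs, hy⟩
    refine ⟨r + s, add_nonneg hr hs, ?_⟩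
    rw [add_smul]
    exact (abs_add_le x y).trans (add_le_add hx hy)
  zero_mem' := ⟨0, le_rfl, by simp⟩
  smul_mem' := by
    rintro c x ⟨r, hr, hx⟩
    refine ⟨|c| * r, mul_nonneg (abs_nonneg c) hr, ?_⟩
    rw [mul_smul]
    exact (abs_smul_le c x).trans (smul_le_smul_of_nonneg_left hx (abs_nonneg c))

theorem mem_orderIdeal_of_abs_le {e x : X} (h : |x| ≤ e) : x ∈ orderIdeal e :=
  ⟨1, zero_le_one, by simpa using h⟩

theorem abs_sup_le_add (x y : X) : |x ⊔ y| ≤ |x| + |y| := by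
  have hx := abs_nonneg x
  have hy := abs_nonneg y
  refine abs_le'.2 ⟨sup_le ?_ ?_, ?_⟩
  · exact (le_abs_self x).trans (le_add_of_nonneg_right hy)
  · exact (le_abs_self y).trans (le_add_of_nonneg_left hx)
  · exact (neg_le_neg le_sup_left).trans ((neg_le_abs x).trans (le_add_of_nonneg_right hy))

theorem abs_inf_le_add (x y : X) : |x ⊓ y| ≤ |x| + |y| := by
  have h := abs_sup_le_add (-x) (-y)
  rwa [← neg_inf, abs_neg, abs_neg, abs_neg] at h

theorem orderIdeal_of_abs_le_add {e x y z : X} (hx : x ∈ orderIdeal e) (hy : y ∈ orderIdeal e)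
    (h : |z| ≤ |x| + |y|) : z ∈ orderIdeal e := by
  obtain ⟨r, hr, hx⟩ := hx
  obtain ⟨s, hs, hy⟩ := hy
  refine ⟨r + s, add_nonneg hr hs, h.trans ?_⟩
  rw [add_smul]
  exact add_le_add hx hy

/-- The lattice operations of `I_e` are those of `X`. -/
instance (e : X) : Lattice (orderIdeal e) :=
  Subtype.lattice
    (fun _ _ hx hy => orderIdeal_of_abs_le_add hx hy (abs_sup_le_add _ _))
    (fun _ _ hx hy => orderIdeal_of_abs_le_add hx hy (abs_inf_le_add _ _))

/-- The number `‖x‖_e = inf {r ≥ 0 : |x| ≤ r e}`. -/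
noncomputable def gauge (e x : X) : ℝ := sInf {r : ℝ | 0 ≤ r ∧ |x| ≤ r • e}

theorem gauge_le {e x : X} {r : ℝ} (hr : 0 ≤ r) (h : |x| ≤ r • e) : gauge e x ≤ r :=
  csInf_le ⟨0, fun _ hs => hs.1⟩ ⟨hr, h⟩

theorem exists_lt_gauge_add {e x : X} (hx : x ∈ orderIdeal e) {ε : ℝ} (hε : 0 < ε) :
    ∃ r : ℝ, 0 ≤ r ∧ |x| ≤ r • e ∧ r < gauge e x + ε := by
  obtain ⟨r, hr, hlt⟩ := Real.lt_sInf_add_pos (s := {r : ℝ | 0 ≤ r ∧ |x| ≤ r • e}) hx hε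
  exact ⟨r, hr.1, hr.2, hlt⟩

/-- `‖·‖_e` as a seminorm on `I_e`. -/
noncomputable def gaugeSeminorm (e : X) : Seminorm ℝ (orderIdeal e) :=
  Seminorm.ofSMulLE (fun x => gauge e (x : X))
    (le_antisymm (gauge_le le_rfl (by simp)) (Real.sInf_nonneg fun _ h => h.1))
    (by
      intro x y
      refine le_of_forall_pos_le_add fun ε hε => ?_
      obtain ⟨r, hr, hx, hr'⟩ := exists_lt_gauge_add x.2 (half_pos hε)
      obtain ⟨s, hs, hy, hs'⟩ := exists_lt_gauge_add y.2 (half_pos hε)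
      have h : gauge e ((x + y : orderIdeal e) : X) ≤ r + s := by
        refine gauge_le (add_nonneg hr hs) ?_
        rw [add_smul]
        exact (abs_add_le (x : X) (y : X)).trans (add_le_add hx hy)
      linarith)
    (by
      intro c x
      rw [Real.norm_eq_abs]
      refine le_of_forall_pos_le_add fun ε hε => ?_
      have hc : 0 < |c| + 1 := by positivity
      obtain ⟨r, hr, hx, hr'⟩ := exists_lt_gauge_add x.2 (div_pos hε hc)
      have h : gauge e ((c • x : orderIdeal e) : X) ≤ |c| * r := by
        refine gauge_le (mul_nonneg (abs_nonneg c) hr) ?_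
        rw [mul_smul]
        exact (abs_smul_le c (x : X)).trans (smul_le_smul_of_nonneg_left hx (abs_nonneg c))
      have h1 : |c| * r ≤ |c| * (gauge e (x : X) + ε / (|c| + 1)) :=
        mul_le_mul_of_nonneg_left hr'.le (abs_nonneg c)
      have h2 : |c| * (ε / (|c| + 1)) ≤ ε := by
        rw [mul_div_assoc', div_le_iff₀ hc]
        nlinarith [abs_nonneg c]
      linarith)

/-- The norm (a seminorm if `X` is not Archimedean), metric and topology on `I_e` are those
given by `‖·‖_e`. -/
noncomputable instance (e : X) : SeminormedAddCommGroup (orderIdeal e) :=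
  (gaugeSeminorm e).toAddGroupSeminorm.toSeminormedAddCommGroup

theorem norm_orderIdeal (e : X) (x : orderIdeal e) :
    ‖x‖ = sInf {r : ℝ | 0 ≤ r ∧ |(x : X)| ≤ r • e} := rfl

/-- If `X` is Archimedean, then `‖·‖_e` is a norm on `I_e`. -/
theorem eq_zero_of_norm_orderIdeal (hX : IsArchimedean X) {e : X} (x : orderIdeal e)
    (hx : ‖x‖ = 0) : x = 0 := by
  have hg : gauge e (x : X) = 0 := hx
  have key : ∀ n : ℕ, n • |(x : X)| ≤ |e| := by
    intro n
    have hn : (0 : ℝ) < (n : ℝ) + 1 := by positivity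
    obtain ⟨r, hr, hxr, hlt⟩ := exists_lt_gauge_add x.2 (inv_pos.2 hn)
    rw [hg, zero_add] at hlt
    have h1 : |(x : X)| ≤ r • |e| :=
      hxr.trans (smul_le_smul_of_nonneg_left (le_abs_self e) hr)
    have h2 : (n : ℝ) • |(x : X)| ≤ (n : ℝ) • r • |e| :=
      smul_le_smul_of_nonneg_left h1 n.cast_nonneg
    have h3 : (n : ℝ) * r ≤ 1 := by
      have h4 : ((n : ℝ) + 1) * r ≤ ((n : ℝ) + 1) * ((n : ℝ) + 1)⁻¹ :=
        mul_le_mul_of_nonneg_left hlt.le hn.le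
      rw [mul_inv_cancel₀ hn.ne'] at h4
      linarith
    rw [smul_smul, Nat.cast_smul_eq_nsmul] at h2
    refine h2.trans ?_
    simpa using smul_le_smul_of_nonneg_right h3 (abs_nonneg e)
  have h0 : |(x : X)| = 0 := hX _ _ (abs_nonneg _) (abs_nonneg _) key
  have hle := (le_abs_self (x : X)).trans h0.le
  have hge := (neg_le_abs (x : X)).trans h0.le
  exact Subtype.ext (le_antisymm hle (neg_nonpos.1 hge))

/-- The closed (linear) sublattice generated by `s`: the intersection of all closed linear
subspaces that are closed under `⊔` and `⊓` and contain `s`. -/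
def closedSublatticeSpan {E : Type*} [AddCommGroup E] [Lattice E] [Module ℝ E]
    [TopologicalSpace E] (s : Set E) : Submodule ℝ E :=
  sInf {S : Submodule ℝ E | IsSublattice (S : Set E) ∧ IsClosed (S : Set E) ∧ s ⊆ S}

/-- The element `|x₁| ⊔ ⋯ ⊔ |xₙ|`, for `n ≥ 1`. -/
def supAbs {n : ℕ} [NeZero n] (x : Fin n → X) : X :=
  Finset.univ.sup' Finset.univ_nonempty fun i => |x i|

/-- If `e ≥ |x₁| ⊔ ⋯ ⊔ |xₙ|`, then `x₁, …, xₙ` belong to `I_e`; this is the tuple `x` there. -/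
def tupleIn {n : ℕ} [NeZero n] (x : Fin n → X) (e : X) (he : supAbs x ≤ e) (i : Fin n) :
    orderIdeal e :=
  ⟨x i, mem_orderIdeal_of_abs_le
    ((Finset.le_sup' (fun i => |x i|) (Finset.mem_univ i)).trans he)⟩

/-- `‖·‖_e` is complete on the closed sublattice of `I_e` generated by `x₁, …, xₙ`. -/
def IsCompleteOnGenerated {n : ℕ} [NeZero n] (x : Fin n → X) (e : X) (he : supAbs x ≤ e) : Prop :=
  IsComplete (closedSublatticeSpan (Set.range (tupleIn x e he)) : Set (orderIdeal e))

end VectorLattice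

end VL

/-!
Write `‖t‖ = max |t i|` on `ℝⁿ` and `e` for an upper bound of the `|x i|`. The space `H n` is
complete for the norm `‖f‖ = inf {r ≥ 0 : |f t| ≤ r ‖t‖ for all t}`, and by the Stone–Weierstrass
theorem on the unit sphere the linear sublattice generated by the coordinate projections is dense
in it (`VL.exists_mem_abs_sub_le`). Everything rests on the fact that evaluating lattice-linear
expressions at `x` is well defined and contractive from this dense sublattice to `(I_e, ‖·‖_e)`
(`VL.norm_snd_le_of_mem_graphSpan`).

The usual proof of that fact uses enough real-valued lattice homomorphisms on `I_e` (Yosida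
representation). Here a weaker object suffices, which takes only finitely many steps to construct.
The functional `p y = inf {r ≥ 0 : y ≤ r e}` is sublinear and preserves binary suprema. Passing to
the directional derivative at infinity `lim (p (y + s u) - s p u)` keeps these properties, makes `p`
smaller, and makes it linear on the line through `u` (`VL.IsSupSublinear.exists_le_neg_eq`). After
doing this for a given `y` and for `x 1, …, x n`, the functional still has the original value at
`y`, and it acts as a lattice homomorphism on the sublattice generated by the `x i`, because the
elements `v` with `p (-v) = -p v` form a linear sublattice on which `p` preserves all operations.
So a lattice-linear expression `f` with value `y` satisfies `p y = f (p (x 1), …, p (x n))`, and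
`|p (x i)| ≤ 1` gives the bound.

If the closed sublattice generated by `x` is complete, evaluation extends by density to all of
`H n`: the extension is the closure of the graph `VL.graphSpan`. Conversely, a homomorphism
`Φ` with `Φ (proj i) = x i` maps `t ↦ ‖t‖` to `e = |x 1| ⊔ ⋯ ⊔ |x n|`. Truncating `f` at `± r ‖t‖`
shows that `‖·‖_e` is the quotient norm on the range of `Φ`, so the range is complete
(`VL.VectorLatticeHom.isComplete_rangeIn`), and the closed sublattice generated by `x` is a closed
subset of it. Two homomorphisms with the same values at the projections agree on a dense
sublattice, hence everywhere because `X` is Archimedean.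
-/

namespace VL

open Filter Topology

/-! ### Sublinear functionals that preserve finite suprema -/

section Sublinear

variable {E : Type*} [AddCommGroup E] [Lattice E] [Module ℝ E]

/-- A sublinear functional on a vector lattice that preserves binary suprema. On `C(K, ℝ)` the
example to keep in mind is `f ↦ max_F f` for a closed set `F ⊆ K`. -/
structure IsSupSublinear (p : E → ℝ) : Prop where
  add_le : ∀ x y, p (x + y) ≤ p x + p y
  smul : ∀ (r : ℝ) (x : E), 0 ≤ r → p (r • x) = r * p x
  sup : ∀ x y, p (x ⊔ y) = max (p x) (p y)

namespace IsSupSublinear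

variable {p : E → ℝ}

theorem map_zero (hp : IsSupSublinear p) : p 0 = 0 := by
  simpa using hp.smul 0 0 le_rfl

theorem mono (hp : IsSupSublinear p) {x y : E} (h : x ≤ y) : p x ≤ p y := by
  have := hp.sup x y
  rw [sup_eq_right.2 h] at this
  rw [this]
  exact le_max_left _ _

theorem neg_le (hp : IsSupSublinear p) (x : E) : -p (-x) ≤ p x := by
  have := hp.add_le x (-x)
  rw [add_neg_cancel, hp.map_zero] at this
  linarith

/-- The condition `p (-x) = -p x` says that `p` is linear on the line through `x`. -/
theorem add_of_neg (hp : IsSupSublinear p) {x : E} (hx : p (-x) = -p x) (y : E) :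
    p (x + y) = p x + p y := by
  refine le_antisymm (hp.add_le x y) ?_
  have := hp.add_le (-x) (x + y)
  rw [neg_add_cancel_left] at this
  linarith

theorem neg_add_of_neg (hp : IsSupSublinear p) {x y : E} (hx : p (-x) = -p x)
    (hy : p (-y) = -p y) : p (-(x + y)) = -p (x + y) := by
  rw [neg_add, hp.add_of_neg (by rw [neg_neg, hx, neg_neg]), hp.add_of_neg hx, hx, hy]
  ring

theorem smul_of_neg (hp : IsSupSublinear p) {x : E} (hx : p (-x) = -p x) (c : ℝ) :
    p (c • x) = c * p x := by
  rcases le_total 0 c with hc | hc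
  · exact hp.smul c x hc
  · have := hp.smul (-c) (-x) (by linarith)
    rw [neg_smul_neg, hx] at this
    linarith

theorem neg_smul_of_neg (hp : IsSupSublinear p) {x : E} (hx : p (-x) = -p x) (c : ℝ) :
    p (-(c • x)) = -p (c • x) := by
  rw [← neg_smul, hp.smul_of_neg hx, hp.smul_of_neg hx]
  ring

/-- A sublinear functional keeps its values on lines where it is linear when it is made smaller. -/
theorem eq_of_le_of_neg {q : E → ℝ} (hq : IsSupSublinear q) (h : ∀ x, q x ≤ p x) {v : E}
    (hv : p (-v) = -p v) : q v = p v ∧ q (-v) = -q v := by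
  have h1 := h v
  have h2 := h (-v)
  have h3 := hq.neg_le v
  constructor <;> linarith

variable [IsOrderedAddMonoid E]

/-- Since `x ⊓ y + x ⊔ y = x + y`, additivity in the direction `x` turns preservation of suprema
into preservation of infima. -/
theorem inf_of_neg (hp : IsSupSublinear p) {x y : E} (hx : p (-x) = -p x) :
    p (x ⊓ y) = min (p x) (p y) := by
  refine le_antisymm (le_min (hp.mono inf_le_left) (hp.mono inf_le_right)) ?_
  have h := hp.add_le (x ⊓ y) (x ⊔ y)
  rw [inf_add_sup, hp.add_of_neg hx, hp.sup] at h
  have := min_add_max (p x) (p y)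
  linarith

theorem neg_sup_of_neg (hp : IsSupSublinear p) {x y : E} (hx : p (-x) = -p x)
    (hy : p (-y) = -p y) : p (-(x ⊔ y)) = -p (x ⊔ y) := by
  rw [neg_sup, hp.inf_of_neg (by rw [neg_neg, hx, neg_neg]), hp.sup, hx, hy, min_neg_neg]

theorem neg_inf_of_neg (hp : IsSupSublinear p) {x y : E} (hx : p (-x) = -p x)
    (hy : p (-y) = -p y) : p (-(x ⊓ y)) = -p (x ⊓ y) := by
  rw [neg_inf, hp.inf_of_neg hx, hp.sup, hx, hy, max_neg_neg]


/-- The directional derivative of `p` at infinity along `u`, that is,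
`q x = lim_{s → ∞} (p (x + s • u) - s * p u)`, is again sublinear and preserves suprema; it is
below `p`, and it is linear on the line through `u`. In the example `p = max_F`, it replaces `F` by
the set of points of `F` where `u` attains its maximum. -/
theorem exists_le_neg_eq (hp : IsSupSublinear p) (u : E) :
    ∃ q : E → ℝ, IsSupSublinear q ∧ (∀ x, q x ≤ p x) ∧ q (-u) = -p u := by
  set F : E → ℝ → ℝ := fun x s => p (x + s • u) - s * p u with hF
  have anti : ∀ x, Antitone (F x) := by
    intro x s s' h
    have h1 := hp.add_le (x + s • u) ((s' - s) • u)
    rw [hp.smul _ _ (sub_nonneg.2 h), add_assoc, ← add_smul, add_sub_cancel] at h1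
    simp only [hF]
    linarith
  have bdd : ∀ x s, -p (-x) ≤ F x s := by
    intro x s
    refine le_trans ?_ (anti x (le_max_left s 0))
    have h1 := hp.add_le (x + max s 0 • u) (-x)
    rw [add_neg_cancel_comm, hp.smul _ _ (le_max_right s 0)] at h1
    simp only [hF]
    linarith
  have lim : ∀ x, ∃ a, Tendsto (F x) atTop (𝓝 a) := fun x =>
    ⟨_, tendsto_atTop_ciInf (anti x) ⟨-p (-x), by rintro _ ⟨s, rfl⟩; exact bdd x s⟩⟩
  choose q hq using lim
  refine ⟨q, ⟨fun x y => ?_, fun r x hr => ?_, fun x y => ?_⟩, fun x => ?_, ?_⟩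
  -- `F x s + F y s ≥ F (x + y) (2 * s)`, and both sides converge.
  · have h2 : Tendsto (fun s : ℝ => F (x + y) (2 * s)) atTop (𝓝 (q (x + y))) :=
      (hq (x + y)).comp (tendsto_id.const_mul_atTop two_pos)
    refine le_of_tendsto_of_tendsto' h2 ((hq x).add (hq y)) fun s => ?_
    have h1 := hp.add_le (x + s • u) (y + s • u)
    rw [add_add_add_comm, ← add_smul, ← two_mul] at h1
    simp only [hF]
    linarith
  · rcases hr.eq_or_lt with rfl | hr
    · refine tendsto_nhds_unique (hq _) (tendsto_const_nhds.congr' ?_)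
      filter_upwards [eventually_ge_atTop 0] with s hs
      simp [hF, hp.smul s u hs]
    · have h2 : Tendsto (fun s : ℝ => r * F x (r⁻¹ * s)) atTop (𝓝 (r * q x)) :=
        ((hq x).comp (tendsto_id.const_mul_atTop (inv_pos.2 hr))).const_mul r
      refine tendsto_nhds_unique (hq _) (h2.congr fun s => ?_)
      have h1 : r • x + s • u = r • (x + (r⁻¹ * s) • u) := by
        rw [smul_add, smul_smul, mul_inv_cancel_left₀ hr.ne']
      simp only [hF, h1, hp.smul r _ hr.le]
      field_simp
  · refine tendsto_nhds_unique (hq _) (((hq x).max (hq y)).congr fun s => ?_)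
    simp only [hF, sup_add, hp.sup, max_sub_sub_right]
  · simpa [hF] using le_of_tendsto (hq x) ((eventually_ge_atTop 0).mono fun s hs => anti x hs)
  · refine tendsto_nhds_unique (hq _) (tendsto_const_nhds.congr' ?_)
    filter_upwards [eventually_ge_atTop 1] with s hs
    have h1 : -u + s • u = (s - 1) • u := by rw [sub_smul, one_smul]; abel
    simp only [hF, h1, hp.smul (s - 1) u (sub_nonneg.2 hs)]
    ring

/-- Below `p` there is a sup-preserving sublinear functional that is linear on the line through
each element of a finite set, and that keeps the value of `p` at `u`. -/
theorem exists_le_forall_neg (hp : IsSupSublinear p) (u : E) (s : Finset E) :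
    ∃ q : E → ℝ, IsSupSublinear q ∧ (∀ x, q x ≤ p x) ∧ q u = p u ∧ ∀ v ∈ s, q (-v) = -q v := by
  classical
  suffices h : ∃ q : E → ℝ, IsSupSublinear q ∧ (∀ x, q x ≤ p x) ∧ q u = p u ∧ q (-u) = -q u ∧
      ∀ v ∈ s, q (-v) = -q v by
    obtain ⟨q, h1, h2, h3, -, h4⟩ := h
    exact ⟨q, h1, h2, h3, h4⟩
  induction s using Finset.induction_on with
  | empty =>
    obtain ⟨q, hq, hle, hu⟩ := hp.exists_le_neg_eq u
    have h1 := hle u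
    have h2 := hq.neg_le u
    have h3 : q u = p u := by linarith
    exact ⟨q, hq, hle, h3, by rw [h3, hu], by simp⟩
  | insert a s _ ih =>
    obtain ⟨q, hq, hle, hu, hu', hs⟩ := ih
    obtain ⟨q', hq', hle', ha⟩ := hq.exists_le_neg_eq a
    have hu2 := hq'.eq_of_le_of_neg hle' hu'
    refine ⟨q', hq', fun x => (hle' x).trans (hle x), hu2.1.trans hu, hu2.2, fun v hv => ?_⟩
    rcases Finset.mem_insert.1 hv with rfl | hv
    · have h1 := hle' v
      have h2 := hq'.neg_le v
      linarith
    · exact (hq'.eq_of_le_of_neg hle' (hs v hv)).2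

end IsSupSublinear

end Sublinear

/-! ### The norm of a principal ideal -/

section LatticeGroup

variable {X : Type*} [AddCommGroup X] [Lattice X] [IsOrderedAddMonoid X]

theorem abs_sup_sub_sup_le_add (a b c d : X) : |a ⊔ b - c ⊔ d| ≤ |a - c| + |b - d| := by
  rw [← sub_add_sub_cancel _ (c ⊔ b)]
  refine (abs_add_le _ _).trans (add_le_add (abs_sup_sub_sup_le_abs _ _ _) ?_)
  rw [sup_comm c, sup_comm c]
  exact abs_sup_sub_sup_le_abs _ _ _

theorem abs_inf_sub_inf_le_add (a b c d : X) : |a ⊓ b - c ⊓ d| ≤ |a - c| + |b - d| := by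
  rw [← sub_add_sub_cancel _ (c ⊓ b)]
  refine (abs_add_le _ _).trans (add_le_add (abs_inf_sub_inf_le_abs _ _ _) ?_)
  rw [inf_comm c, inf_comm c]
  exact abs_inf_sub_inf_le_abs _ _ _

theorem supAbs_nonneg {n : ℕ} [NeZero n] (x : Fin n → X) : 0 ≤ supAbs x :=
  (abs_nonneg (x 0)).trans (Finset.le_sup' (fun i => |x i|) (Finset.mem_univ 0))

end LatticeGroup

section Ideal

variable {X : Type*} [AddCommGroup X] [Lattice X] [IsOrderedAddMonoid X] [Module ℝ X]
  [IsOrderedModule ℝ X]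

theorem IsArchimedean.le_smul_of_forall_pos (hX : IsArchimedean X) {e a : X} (he : 0 ≤ e) {r : ℝ}
    (h : ∀ ε : ℝ, 0 < ε → a ≤ (r + ε) • e) : a ≤ r • e := by
  have key : (a - r • e) ⊔ 0 = 0 := by
    refine hX _ e le_sup_right he fun k => ?_
    have hk : (0 : ℝ) < (k : ℝ) + 1 := by positivity
    have h1 : (a - r • e) ⊔ 0 ≤ ((k : ℝ) + 1)⁻¹ • e := by
      refine sup_le ?_ (smul_nonneg (inv_pos.2 hk).le he)
      rw [sub_le_iff_le_add', ← add_smul]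
      exact h _ (inv_pos.2 hk)
    have h2 := smul_le_smul_of_nonneg_left h1 (Nat.cast_nonneg (α := ℝ) k)
    rw [smul_smul, Nat.cast_smul_eq_nsmul] at h2
    refine h2.trans ?_
    have h3 : (k : ℝ) * ((k : ℝ) + 1)⁻¹ ≤ 1 := by
      rw [← div_eq_mul_inv, div_le_one hk]
      linarith
    simpa using smul_le_smul_of_nonneg_right h3 he
  exact sub_nonpos.1 (sup_eq_right.1 key)

theorem norm_le_iff (hX : IsArchimedean X) {e : X} (he : 0 ≤ e) (y : orderIdeal e) {r : ℝ}
    (hr : 0 ≤ r) : ‖y‖ ≤ r ↔ |(y : X)| ≤ r • e := by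
  refine ⟨fun h => hX.le_smul_of_forall_pos he fun ε hε => ?_, gauge_le hr⟩
  obtain ⟨s, -, hs, hlt⟩ := exists_lt_gauge_add y.2 hε
  have h' : gauge e (y : X) ≤ r := h
  exact hs.trans (smul_le_smul_of_nonneg_right (by linarith) he)

theorem norm_sup_sub_sup_le (hX : IsArchimedean X) {e : X} (he : 0 ≤ e) (y y' z z' : orderIdeal e) :
    ‖y ⊔ y' - z ⊔ z'‖ ≤ ‖y - z‖ + ‖y' - z'‖ := by
  rw [norm_le_iff hX he _ (by positivity), add_smul]
  have h1 := (norm_le_iff hX he (y - z) (norm_nonneg _)).1 le_rfl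
  have h2 := (norm_le_iff hX he (y' - z') (norm_nonneg _)).1 le_rfl
  exact (abs_sup_sub_sup_le_add (y : X) y' z z').trans (add_le_add h1 h2)

theorem norm_inf_sub_inf_le (hX : IsArchimedean X) {e : X} (he : 0 ≤ e) (y y' z z' : orderIdeal e) :
    ‖y ⊓ y' - z ⊓ z'‖ ≤ ‖y - z‖ + ‖y' - z'‖ := by
  rw [norm_le_iff hX he _ (by positivity), add_smul]
  have h1 := (norm_le_iff hX he (y - z) (norm_nonneg _)).1 le_rfl
  have h2 := (norm_le_iff hX he (y' - z') (norm_nonneg _)).1 le_rfl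
  exact (abs_inf_sub_inf_le_add (y : X) y' z z').trans (add_le_add h1 h2)

/-- The number `inf {r ≥ 0 : y ≤ r e}`, which is the norm of the positive part of `y ∈ I_e`. -/
noncomputable def upperGauge (e : X) (y : orderIdeal e) : ℝ :=
  sInf {r : ℝ | 0 ≤ r ∧ (y : X) ≤ r • e}

theorem upperGauge_nonneg (e : X) (y : orderIdeal e) : 0 ≤ upperGauge e y :=
  Real.sInf_nonneg fun _ h => h.1

theorem upperGauge_le_iff (hX : IsArchimedean X) {e : X} (he : 0 ≤ e) (y : orderIdeal e) {r : ℝ}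
    (hr : 0 ≤ r) : upperGauge e y ≤ r ↔ (y : X) ≤ r • e := by
  constructor
  · refine fun h => hX.le_smul_of_forall_pos he fun ε hε => ?_
    obtain ⟨t, ht, hyt⟩ := y.2
    obtain ⟨s, hs, hlt⟩ := Real.lt_sInf_add_pos (s := {r : ℝ | 0 ≤ r ∧ (y : X) ≤ r • e})
      ⟨t, ht, (le_abs_self _).trans hyt⟩ hε
    have h' : sInf {r : ℝ | 0 ≤ r ∧ (y : X) ≤ r • e} ≤ r := h
    exact hs.2.trans (smul_le_smul_of_nonneg_right (by linarith) he)
  · exact fun h => csInf_le ⟨0, fun _ hs => hs.1⟩ ⟨hr, h⟩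

theorem le_upperGauge_smul (hX : IsArchimedean X) {e : X} (he : 0 ≤ e) (y : orderIdeal e) :
    (y : X) ≤ upperGauge e y • e :=
  (upperGauge_le_iff hX he y (upperGauge_nonneg e y)).1 le_rfl

theorem isSupSublinear_upperGauge (hX : IsArchimedean X) {e : X} (he : 0 ≤ e) :
    IsSupSublinear (upperGauge e) := by
  have smul_le : ∀ (r : ℝ) (y : orderIdeal e), 0 ≤ r →
      upperGauge e (r • y) ≤ r * upperGauge e y := by
    intro r y hr
    rw [upperGauge_le_iff hX he _ (mul_nonneg hr (upperGauge_nonneg e y)), mul_smul]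
    exact smul_le_smul_of_nonneg_left (le_upperGauge_smul hX he y) hr
  refine ⟨fun x y => ?_, fun r y hr => le_antisymm (smul_le r y hr) ?_,
    fun x y => le_antisymm ?_ ?_⟩
  · rw [upperGauge_le_iff hX he _ (add_nonneg (upperGauge_nonneg e x) (upperGauge_nonneg e y)),
      add_smul]
    exact add_le_add (le_upperGauge_smul hX he x) (le_upperGauge_smul hX he y)
  · rcases hr.eq_or_lt with rfl | hr
    · simpa using upperGauge_nonneg e _
    · have := smul_le r⁻¹ (r • y) (inv_pos.2 hr).le
      rwa [inv_smul_smul₀ hr.ne', ← div_eq_inv_mul, le_div_iff₀' hr] at this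
  · have h0 := (upperGauge_nonneg e x).trans (le_max_left _ (upperGauge e y))
    rw [upperGauge_le_iff hX he _ h0]
    exact sup_le ((le_upperGauge_smul hX he x).trans
        (smul_le_smul_of_nonneg_right (le_max_left _ _) he))
      ((le_upperGauge_smul hX he y).trans (smul_le_smul_of_nonneg_right (le_max_right _ _) he))
  · have h := le_upperGauge_smul hX he (x ⊔ y)
    refine max_le ?_ ?_
    · rw [upperGauge_le_iff hX he _ (upperGauge_nonneg _ _)]
      exact (le_sup_left (a := (x : X)) (b := y)).trans h
    · rw [upperGauge_le_iff hX he _ (upperGauge_nonneg _ _)]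
      exact (le_sup_right (a := (x : X)) (b := y)).trans h

end Ideal

/-! ### Linear sublattices generated by tuples -/

/-- The linear sublattice generated by a set. -/
def sublatticeSpan {E : Type*} [AddCommGroup E] [Lattice E] [Module ℝ E] (s : Set E) :
    Submodule ℝ E :=
  sInf {S : Submodule ℝ E | IsSublattice (S : Set E) ∧ s ⊆ S}

section Span

variable {E : Type*} [AddCommGroup E] [Lattice E] [Module ℝ E]

theorem subset_sublatticeSpan (s : Set E) : s ⊆ sublatticeSpan s := by
  intro a ha
  simp only [sublatticeSpan, SetLike.mem_coe, Submodule.mem_sInf]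
  exact fun S hS => hS.2 ha

theorem sublatticeSpan_le {s : Set E} {S : Submodule ℝ E} (hS : IsSublattice (S : Set E))
    (h : s ⊆ S) : sublatticeSpan s ≤ S :=
  sInf_le ⟨hS, h⟩

theorem isSublattice_sublatticeSpan (s : Set E) : IsSublattice (sublatticeSpan s : Set E) := by
  constructor
  · intro a ha b hb
    simp only [sublatticeSpan, SetLike.mem_coe, Submodule.mem_sInf] at ha hb ⊢
    exact fun S hS => hS.1.supClosed (ha S hS) (hb S hS)
  · intro a ha b hb
    simp only [sublatticeSpan, SetLike.mem_coe, Submodule.mem_sInf] at ha hb ⊢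
    exact fun S hS => hS.1.infClosed (ha S hS) (hb S hS)

variable [TopologicalSpace E]

theorem subset_closedSublatticeSpan (s : Set E) : s ⊆ closedSublatticeSpan s := by
  intro a ha
  simp only [closedSublatticeSpan, SetLike.mem_coe, Submodule.mem_sInf]
  exact fun S hS => hS.2.2 ha

theorem closedSublatticeSpan_le {s : Set E} {S : Submodule ℝ E} (hS : IsSublattice (S : Set E))
    (hc : IsClosed (S : Set E)) (h : s ⊆ S) : closedSublatticeSpan s ≤ S :=
  sInf_le ⟨hS, hc, h⟩

theorem isSublattice_closedSublatticeSpan (s : Set E) :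
    IsSublattice (closedSublatticeSpan s : Set E) := by
  constructor
  · intro a ha b hb
    simp only [closedSublatticeSpan, SetLike.mem_coe, Submodule.mem_sInf] at ha hb ⊢
    exact fun S hS => hS.1.supClosed (ha S hS) (hb S hS)
  · intro a ha b hb
    simp only [closedSublatticeSpan, SetLike.mem_coe, Submodule.mem_sInf] at ha hb ⊢
    exact fun S hS => hS.1.infClosed (ha S hS) (hb S hS)

theorem isClosed_closedSublatticeSpan (s : Set E) :
    IsClosed (closedSublatticeSpan s : Set E) := by
  simp only [closedSublatticeSpan, Submodule.coe_sInf]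
  exact isClosed_biInter fun S hS => hS.2.1

end Span

/-! ### Positively homogeneous functions -/

section Homogeneous

variable {n : ℕ}

theorem H.map_zero (f : H n) : f.1 0 = 0 := by
  simpa using f.2 0 0 le_rfl

/-- The function `t ↦ ‖t‖ = max |t i|`, as an element of `H n`. -/
def normFun (n : ℕ) : H n :=
  ⟨⟨fun t => ‖t‖, continuous_norm⟩, fun r t hr => by simp [norm_smul, abs_of_nonneg hr]⟩

theorem normFun_eq_supAbs [NeZero n] : normFun n = supAbs (proj : Fin n → H n) := by
  refine le_antisymm ?_ ?_
  · intro t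
    change ‖t‖ ≤ (supAbs (proj : Fin n → H n)).1 t
    have h : ∀ i, ‖t i‖ ≤ (supAbs (proj : Fin n → H n)).1 t := by
      intro i
      have := Finset.le_sup' (fun i => |(proj i : H n)|) (Finset.mem_univ i)
      exact this t
    exact (pi_norm_le_iff_of_nonneg ((norm_nonneg _).trans (h 0))).2 h
  · refine Finset.sup'_le _ _ fun i _ t => ?_
    exact norm_le_pi_norm t i

/-- By the Stone–Weierstrass theorem on the unit sphere, where `normFun n` is the constant `1`, a
linear sublattice that contains the coordinate projections is dense in `H n`. -/
theorem exists_mem_abs_sub_le [NeZero n] {S : Submodule ℝ (H n)} (hS : IsSublattice (S : Set (H n)))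
    (hproj : ∀ i, proj i ∈ S) (f : H n) {ε : ℝ} (hε : 0 < ε) :
    ∃ g ∈ S, ∀ t, |f.1 t - g.1 t| ≤ ε * ‖t‖ := by
  have hnorm : normFun n ∈ S := by
    rw [normFun_eq_supAbs]
    refine hS.supClosed.finsetSup'_mem _ fun i _ => ?_
    exact hS.supClosed (hproj i) (S.neg_mem (hproj i))
  let K := Metric.sphere (0 : Fin n → ℝ) 1
  let ρ : H n → C(K, ℝ) := fun g => g.1.restrict K
  have hdense := ContinuousMap.sublattice_closure_eq_top (ρ '' S) ⟨_, 0, S.zero_mem, rfl⟩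
    (by
      rintro _ ⟨a, ha, rfl⟩ _ ⟨b, hb, rfl⟩
      exact ⟨a ⊓ b, hS.infClosed ha hb, rfl⟩)
    (by
      rintro _ ⟨a, ha, rfl⟩ _ ⟨b, hb, rfl⟩
      exact ⟨a ⊔ b, hS.supClosed ha hb, rfl⟩)
    (by
      intro v a b
      have ha : ‖(a : Fin n → ℝ)‖ = 1 := by simp
      have hb : ‖(b : Fin n → ℝ)‖ = 1 := by simp
      by_cases hab : a = b
      · subst hab
        refine ⟨_, ⟨v a • normFun n, S.smul_mem _ hnorm, rfl⟩, ?_, ?_⟩ <;>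
        · change v a * ‖(a : Fin n → ℝ)‖ = v a
          rw [ha, mul_one]
      · obtain ⟨i, hi⟩ : ∃ i, (a : Fin n → ℝ) i ≠ (b : Fin n → ℝ) i := by
          by_contra! h
          exact hab (Subtype.ext (funext h))
        have hi' := sub_ne_zero.2 hi
        set c : ℝ := (v a - v b) / ((a : Fin n → ℝ) i - (b : Fin n → ℝ) i) with hc
        have hc' : c * ((a : Fin n → ℝ) i - (b : Fin n → ℝ) i) = v a - v b :=
          div_mul_cancel₀ _ hi'
        refine ⟨_, ⟨c • proj i + (v a - c * (a : Fin n → ℝ) i) • normFun n,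
          S.add_mem (S.smul_mem _ (hproj i)) (S.smul_mem _ hnorm), rfl⟩, ?_, ?_⟩
        · change c * (a : Fin n → ℝ) i + (v a - c * (a : Fin n → ℝ) i) * ‖(a : Fin n → ℝ)‖ = v a
          rw [ha]; ring
        · change c * (b : Fin n → ℝ) i + (v a - c * (a : Fin n → ℝ) i) * ‖(b : Fin n → ℝ)‖ = v b
          rw [hb]; linarith)
  have hf : ρ f ∈ closure (ρ '' (S : Set (H n))) := by rw [hdense]; trivial
  obtain ⟨_, ⟨g, hg, rfl⟩, hlt⟩ := Metric.mem_closure_iff.1 hf ε hε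
  refine ⟨g, hg, fun t => ?_⟩
  rcases eq_or_ne t 0 with rfl | ht
  · simp [H.map_zero]
  · have ht' : 0 < ‖t‖ := norm_pos_iff.2 ht
    have h1 : ‖‖t‖⁻¹ • t‖ = 1 := by simp [norm_smul, ht'.ne']
    have h2 := (ContinuousMap.dist_apply_le_dist (f := ρ f) (g := ρ g)
      ⟨‖t‖⁻¹ • t, by simpa [K] using h1⟩).trans hlt.le
    rw [Real.dist_eq] at h2
    change |f.1 (‖t‖⁻¹ • t) - g.1 (‖t‖⁻¹ • t)| ≤ ε at h2
    rw [f.2 _ _ (inv_nonneg.2 ht'.le), g.2 _ _ (inv_nonneg.2 ht'.le), ← mul_sub, abs_mul,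
      abs_of_pos (inv_pos.2 ht'), ← div_eq_inv_mul, div_le_iff₀ ht'] at h2
    exact h2

end Homogeneous

/-! ### From completeness to a homomorphism -/

section Existence

variable {X : Type*} [AddCommGroup X] [Lattice X] [IsOrderedAddMonoid X] [Module ℝ X]
  [IsOrderedModule ℝ X] {n : ℕ} [NeZero n]

/-- The linear sublattice of `H n × I_e` generated by the pairs `(proj i, x i)`: the graph of the
homomorphism that evaluates lattice-linear expressions at `x`. -/
def graphSpan (x : Fin n → X) (e : X) (he : supAbs x ≤ e) : Submodule ℝ (H n × orderIdeal e) :=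
  sublatticeSpan (Set.range fun i => (proj i, tupleIn x e he i))

theorem exists_mem_graphSpan (x : Fin n → X) (e : X) (he : supAbs x ≤ e) (f : H n) {ε : ℝ}
    (hε : 0 < ε) : ∃ a ∈ graphSpan x e he, ∀ t, |f.1 t - a.1.1 t| ≤ ε * ‖t‖ := by
  have hsub := isSublattice_sublatticeSpan
    (Set.range fun i => ((proj i : H n), tupleIn x e he i))
  obtain ⟨_, ⟨a, ha, rfl⟩, h⟩ :=
    exists_mem_abs_sub_le (S := (graphSpan x e he).map (LinearMap.fst ℝ (H n) (orderIdeal e)))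
    ⟨by rintro _ ⟨a, ha, rfl⟩ _ ⟨b, hb, rfl⟩; exact ⟨a ⊔ b, hsub.supClosed ha hb, rfl⟩,
      by rintro _ ⟨a, ha, rfl⟩ _ ⟨b, hb, rfl⟩; exact ⟨a ⊓ b, hsub.infClosed ha hb, rfl⟩⟩
    (fun i => ⟨_, subset_sublatticeSpan _ ⟨i, rfl⟩, rfl⟩) f hε
  exact ⟨a, ha, h⟩

theorem snd_mem_of_mem_graphSpan {x : Fin n → X} {e : X} {he : supAbs x ≤ e}
    {a : H n × orderIdeal e} (ha : a ∈ graphSpan x e he) :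
    a.2 ∈ closedSublatticeSpan (Set.range (tupleIn x e he)) := by
  have hsub := isSublattice_closedSublatticeSpan (Set.range (tupleIn x e he))
  refine sublatticeSpan_le (S := (closedSublatticeSpan (Set.range (tupleIn x e he))).comap
    (LinearMap.snd ℝ (H n) (orderIdeal e))) ⟨?_, ?_⟩ ?_ ha
  · exact fun a ha b hb => hsub.supClosed ha hb
  · exact fun a ha b hb => hsub.infClosed ha hb
  · rintro _ ⟨i, rfl⟩
    exact subset_closedSublatticeSpan _ ⟨i, rfl⟩

/-- A sup-preserving sublinear functional that is linear on the lines through the `x i` evaluates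
every lattice-linear expression in the `x i` as if it were a homomorphism. -/
theorem eval_eq_of_mem_graphSpan {x : Fin n → X} {e : X} {he : supAbs x ≤ e}
    {p : orderIdeal e → ℝ} (hp : IsSupSublinear p)
    (hx : ∀ i, p (-tupleIn x e he i) = -p (tupleIn x e he i)) {a : H n × orderIdeal e}
    (ha : a ∈ graphSpan x e he) : a.1.1 (fun i => p (tupleIn x e he i)) = p a.2 := by
  set τ : Fin n → ℝ := fun i => p (tupleIn x e he i) with hτ
  let S : Submodule ℝ (H n × orderIdeal e) :=
    { carrier := {a | p (-a.2) = -p a.2 ∧ a.1.1 τ = p a.2}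
      zero_mem' := by simp [hp.map_zero]
      add_mem' := fun {a b} ha hb => by
        refine ⟨hp.neg_add_of_neg ha.1 hb.1, ?_⟩
        change a.1.1 τ + b.1.1 τ = p (a.2 + b.2)
        rw [hp.add_of_neg ha.1, ha.2, hb.2]
      smul_mem' := fun c a ha => by
        refine ⟨hp.neg_smul_of_neg ha.1 c, ?_⟩
        change c * a.1.1 τ = p (c • a.2)
        rw [hp.smul_of_neg ha.1, ha.2] }
  have hS : IsSublattice (S : Set (H n × orderIdeal e)) := by
    constructor
    · intro a ha b hb
      refine ⟨hp.neg_sup_of_neg ha.1 hb.1, ?_⟩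
      change max (a.1.1 τ) (b.1.1 τ) = p (a.2 ⊔ b.2)
      rw [hp.sup, ha.2, hb.2]
    · intro a ha b hb
      refine ⟨hp.neg_inf_of_neg ha.1 hb.1, ?_⟩
      change min (a.1.1 τ) (b.1.1 τ) = p (a.2 ⊓ b.2)
      rw [hp.inf_of_neg ha.1, ha.2, hb.2]
  refine (sublatticeSpan_le hS ?_ ha : a ∈ S).2
  rintro _ ⟨i, rfl⟩
  exact ⟨hx i, rfl⟩

/-- Evaluation of lattice-linear expressions at `x` is contractive for the norm of `I_e`. -/
theorem norm_snd_le_of_mem_graphSpan (hX : IsArchimedean X) {x : Fin n → X} {e : X}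
    {he : supAbs x ≤ e} {a : H n × orderIdeal e} (ha : a ∈ graphSpan x e he) {r : ℝ} (hr : 0 ≤ r)
    (h : ∀ t, |a.1.1 t| ≤ r * ‖t‖) : ‖a.2‖ ≤ r := by
  classical
  have he0 : 0 ≤ e := (supAbs_nonneg x).trans he
  have key : ∀ a ∈ graphSpan x e he, (∀ t, a.1.1 t ≤ r * ‖t‖) → (a.2 : X) ≤ r • e := by
    intro a ha h
    rw [← upperGauge_le_iff hX he0 _ hr]
    obtain ⟨p, hp, hle, hpa, hpx⟩ := (isSupSublinear_upperGauge hX he0).exists_le_forall_neg a.2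
      (Finset.univ.image (tupleIn x e he))
    have hpx' : ∀ i, p (-tupleIn x e he i) = -p (tupleIn x e he i) := fun i =>
      hpx _ (Finset.mem_image_of_mem _ (Finset.mem_univ i))
    rw [← hpa, ← eval_eq_of_mem_graphSpan hp hpx' ha]
    -- `|p (x i)| ≤ 1`, since `|x i| ≤ e`.
    have hτ : ‖fun i => p (tupleIn x e he i)‖ ≤ 1 := by
      refine (pi_norm_le_iff_of_nonneg zero_le_one).2 fun i => ?_
      have hi : |x i| ≤ e := (Finset.le_sup' (fun i => |x i|) (Finset.mem_univ i)).trans he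
      rw [Real.norm_eq_abs, abs_le']
      refine ⟨(hle _).trans ?_, ?_⟩
      · rw [upperGauge_le_iff hX he0 _ zero_le_one, one_smul]
        exact (le_abs_self (x i)).trans hi
      · rw [← hpx']
        refine (hle _).trans ?_
        rw [upperGauge_le_iff hX he0 _ zero_le_one, one_smul]
        exact (neg_le_abs (x i)).trans hi
    exact (h _).trans (mul_le_of_le_one_right hr hτ)
  rw [norm_le_iff hX he0 _ hr]
  refine abs_le'.2 ⟨key a ha fun t => (le_abs_self _).trans (h t), ?_⟩
  exact key (-a) ((graphSpan x e he).neg_mem ha) fun t => (neg_le_abs _).trans (h t)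

/-- The pair `(f, y)` lies in the closure of `graphSpan x e he` for the norms of `H n` and `I_e`.
The norm of `H n` is written out as the best constant `r` in `|f t| ≤ r ‖t‖`. -/
def InGraphClosure (x : Fin n → X) (e : X) (he : supAbs x ≤ e) (f : H n) (y : orderIdeal e) :
    Prop :=
  ∀ ε : ℝ, 0 < ε → ∃ a ∈ graphSpan x e he, (∀ t, |f.1 t - a.1.1 t| ≤ ε * ‖t‖) ∧ ‖y - a.2‖ ≤ ε

namespace InGraphClosure

variable {x : Fin n → X} {e : X} {he : supAbs x ≤ e} {f g : H n} {y z : orderIdeal e}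

theorem of_mem {a : H n × orderIdeal e} (ha : a ∈ graphSpan x e he) :
    InGraphClosure x e he a.1 a.2 := fun ε hε =>
  ⟨a, ha, fun t => by simpa using mul_nonneg hε.le (norm_nonneg t), by simpa using hε.le⟩

/-- The closure of the graph is single-valued, because evaluation is contractive. -/
theorem unique (hX : IsArchimedean X) (h : InGraphClosure x e he f y)
    (h' : InGraphClosure x e he f z) : y = z := by
  rw [← sub_eq_zero]
  refine eq_zero_of_norm_orderIdeal hX _ (le_antisymm ?_ (norm_nonneg _))
  refine le_of_forall_pos_le_add fun ε hε => ?_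
  obtain ⟨a, ha, ha1, ha2⟩ := h (ε / 4) (by positivity)
  obtain ⟨b, hb, hb1, hb2⟩ := h' (ε / 4) (by positivity)
  have h1 : ‖(a - b).2‖ ≤ ε / 2 := by
    refine norm_snd_le_of_mem_graphSpan hX ((graphSpan x e he).sub_mem ha hb) (by positivity)
      fun t => ?_
    change |a.1.1 t - b.1.1 t| ≤ _
    have h3 := abs_sub_le (a.1.1 t) (f.1 t) (b.1.1 t)
    rw [abs_sub_comm (a.1.1 t) (f.1 t)] at h3
    linarith [ha1 t, hb1 t]
  have h2 : y - z = (y - a.2) + (a - b).2 - (z - b.2) := by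
    rw [Prod.snd_sub]; abel
  have h3 := norm_sub_le ((y - a.2) + (a - b).2) (z - b.2)
  have h4 := norm_add_le (y - a.2) (a - b).2
  rw [h2]
  linarith

theorem add (h : InGraphClosure x e he f y) (h' : InGraphClosure x e he g z) :
    InGraphClosure x e he (f + g) (y + z) := by
  intro ε hε
  obtain ⟨a, ha, ha1, ha2⟩ := h (ε / 2) (by positivity)
  obtain ⟨b, hb, hb1, hb2⟩ := h' (ε / 2) (by positivity)
  refine ⟨a + b, (graphSpan x e he).add_mem ha hb, fun t => ?_, ?_⟩
  · change |(f.1 t + g.1 t) - (a.1.1 t + b.1.1 t)| ≤ _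
    rw [add_sub_add_comm]
    linarith [abs_add_le (f.1 t - a.1.1 t) (g.1 t - b.1.1 t), ha1 t, hb1 t]
  · rw [Prod.snd_add, add_sub_add_comm]
    linarith [norm_add_le (y - a.2) (z - b.2)]

theorem smul (c : ℝ) (h : InGraphClosure x e he f y) : InGraphClosure x e he (c • f) (c • y) := by
  intro ε hε
  have hc : 0 < |c| + 1 := by positivity
  have hc' : |c| * (ε / (|c| + 1)) ≤ ε := by
    rw [mul_div_assoc', div_le_iff₀ hc]
    nlinarith [abs_nonneg c]
  obtain ⟨a, ha, ha1, ha2⟩ := h (ε / (|c| + 1)) (by positivity)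
  refine ⟨c • a, (graphSpan x e he).smul_mem c ha, fun t => ?_, ?_⟩
  · change |c * f.1 t - c * a.1.1 t| ≤ _
    rw [← mul_sub, abs_mul]
    refine (mul_le_mul_of_nonneg_left (ha1 t) (abs_nonneg c)).trans ?_
    rw [← mul_assoc]
    exact mul_le_mul_of_nonneg_right hc' (norm_nonneg t)
  · rw [Prod.smul_snd, ← smul_sub]
    have : ‖c • (y - a.2)‖ = |c| * ‖y - a.2‖ := map_smul_eq_mul (gaugeSeminorm e) c _
    rw [this]
    exact (mul_le_mul_of_nonneg_left ha2 (abs_nonneg c)).trans hc'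

theorem sup (hX : IsArchimedean X) (h : InGraphClosure x e he f y)
    (h' : InGraphClosure x e he g z) : InGraphClosure x e he (f ⊔ g) (y ⊔ z) := by
  intro ε hε
  obtain ⟨a, ha, ha1, ha2⟩ := h (ε / 2) (by positivity)
  obtain ⟨b, hb, hb1, hb2⟩ := h' (ε / 2) (by positivity)
  refine ⟨a ⊔ b, (isSublattice_sublatticeSpan _).supClosed ha hb, fun t => ?_, ?_⟩
  · change |f.1 t ⊔ g.1 t - a.1.1 t ⊔ b.1.1 t| ≤ _
    linarith [abs_sup_sub_sup_le_add (f.1 t) (g.1 t) (a.1.1 t) (b.1.1 t), ha1 t, hb1 t]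
  · have := norm_sup_sub_sup_le hX ((supAbs_nonneg x).trans he) y z a.2 b.2
    rw [Prod.snd_sup]
    linarith

theorem inf (hX : IsArchimedean X) (h : InGraphClosure x e he f y)
    (h' : InGraphClosure x e he g z) : InGraphClosure x e he (f ⊓ g) (y ⊓ z) := by
  intro ε hε
  obtain ⟨a, ha, ha1, ha2⟩ := h (ε / 2) (by positivity)
  obtain ⟨b, hb, hb1, hb2⟩ := h' (ε / 2) (by positivity)
  refine ⟨a ⊓ b, (isSublattice_sublatticeSpan _).infClosed ha hb, fun t => ?_, ?_⟩
  · change |f.1 t ⊓ g.1 t - a.1.1 t ⊓ b.1.1 t| ≤ _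
    linarith [abs_inf_sub_inf_le_add (f.1 t) (g.1 t) (a.1.1 t) (b.1.1 t), ha1 t, hb1 t]
  · have := norm_inf_sub_inf_le hX ((supAbs_nonneg x).trans he) y z a.2 b.2
    rw [Prod.snd_inf]
    linarith

/-- Completeness makes the closure of the graph a total relation. -/
theorem exists_of_isCompleteOnGenerated (hX : IsArchimedean X)
    (hc : IsCompleteOnGenerated x e he) (f : H n) : ∃ y, InGraphClosure x e he f y := by
  choose a ha hfa using fun k : ℕ =>
    exists_mem_graphSpan x e he f (ε := 1 / ((k : ℝ) + 1)) (by positivity)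
  have hdist : ∀ k l, ‖(a k).2 - (a l).2‖ ≤ 1 / ((k : ℝ) + 1) + 1 / ((l : ℝ) + 1) := by
    intro k l
    refine norm_snd_le_of_mem_graphSpan hX ((graphSpan x e he).sub_mem (ha k) (ha l))
      (by positivity) fun t => ?_
    change |(a k).1.1 t - (a l).1.1 t| ≤ _
    have h3 := abs_sub_le ((a k).1.1 t) (f.1 t) ((a l).1.1 t)
    rw [abs_sub_comm ((a k).1.1 t) (f.1 t)] at h3
    rw [add_mul]
    linarith [hfa k t, hfa l t]
  have hlim := tendsto_one_div_add_atTop_nhds_zero_nat (𝕜 := ℝ)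
  have hcau : CauchySeq fun k => (a k).2 := by
    refine cauchySeq_of_le_tendsto_0 (fun N : ℕ => 1 / ((N : ℝ) + 1) + 1 / ((N : ℝ) + 1))
      (fun k l N hk hl => ?_) (by simpa using hlim.add hlim)
    rw [dist_eq_norm]
    exact (hdist k l).trans (add_le_add (Nat.one_div_le_one_div hk) (Nat.one_div_le_one_div hl))
  obtain ⟨y, -, hy⟩ := cauchySeq_tendsto_of_isComplete hc
    (fun k => snd_mem_of_mem_graphSpan (ha k)) hcau
  refine ⟨y, fun ε hε => ?_⟩
  obtain ⟨k, hk1, hk2⟩ := ((hlim.eventually (gt_mem_nhds hε)).and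
    (hy.eventually (Metric.ball_mem_nhds y hε))).exists
  refine ⟨a k, ha k, fun t => (hfa k t).trans ?_, ?_⟩
  · exact mul_le_mul_of_nonneg_right hk1.le (norm_nonneg t)
  · rw [← dist_eq_norm, dist_comm]
    exact hk2.le

end InGraphClosure

theorem exists_hom_of_isCompleteOnGenerated (hX : IsArchimedean X) {x : Fin n → X} {e : X}
    {he : supAbs x ≤ e} (hc : IsCompleteOnGenerated x e he) :
    ∃ Φ : VectorLatticeHom (H n) X, ∀ i, Φ (proj i) = x i := by
  choose φ hφ using InGraphClosure.exists_of_isCompleteOnGenerated hX hc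
  refine ⟨⟨⟨⟨fun f => (φ f : X), fun f g => ?_⟩, fun c f => ?_⟩, fun f g => ?_, fun f g => ?_⟩,
    fun i => ?_⟩
  · exact congrArg Subtype.val ((hφ (f + g)).unique hX ((hφ f).add (hφ g)))
  · exact congrArg Subtype.val ((hφ (c • f)).unique hX ((hφ f).smul c))
  · exact congrArg Subtype.val ((hφ (f ⊔ g)).unique hX ((hφ f).sup hX (hφ g)))
  · exact congrArg Subtype.val ((hφ (f ⊓ g)).unique hX ((hφ f).inf hX (hφ g)))
  · exact congrArg Subtype.val ((hφ (proj i)).unique hX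
      (InGraphClosure.of_mem (subset_sublatticeSpan _ ⟨i, rfl⟩)))

end Existence

/-! ### From a homomorphism to completeness -/

section Completeness

variable {X : Type*} [AddCommGroup X] [Lattice X] [IsOrderedAddMonoid X] [Module ℝ X]
  [IsOrderedModule ℝ X] {n : ℕ}

/-- `H n` is complete for uniform convergence relative to `t ↦ ‖t‖`: an absolutely convergent
series converges, and the remainders are bounded by the tails. -/
theorem H.exists_sum (g : ℕ → H n) {a : ℕ → ℝ} (ha : Summable a) (ha0 : ∀ i, 0 ≤ a i)
    (hg : ∀ i t, |(g i).1 t| ≤ a i * ‖t‖) :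
    ∃ f : H n, ∀ k t, |f.1 t - (∑ i ∈ Finset.range k, g i).1 t| ≤ (∑' i, a (i + k)) * ‖t‖ := by
  have hsum : ∀ t, Summable fun i => (g i).1 t := fun t =>
    Summable.of_norm_bounded (ha.mul_right ‖t‖) fun i => hg i t
  have hcont : Continuous fun t => ∑' i, (g i).1 t := by
    rw [continuous_iff_continuousAt]
    intro t
    have hball : Metric.ball (0 : Fin n → ℝ) (‖t‖ + 1) ∈ 𝓝 t :=
      Metric.isOpen_ball.mem_nhds (by simp)
    refine ContinuousOn.continuousAt (continuousOn_tsum (fun i => (g i).1.continuous.continuousOn)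
      (ha.mul_right (‖t‖ + 1)) fun i s hs => (hg i s).trans ?_) hball
    exact mul_le_mul_of_nonneg_left (by simpa using (mem_ball_zero_iff.1 hs).le) (ha0 i)
  refine ⟨⟨⟨_, hcont⟩, fun r t hr => ?_⟩, fun k t => ?_⟩
  · simp only [ContinuousMap.coe_mk, (g _).2 r t hr, tsum_mul_left]
  · have h1 : (∑ i ∈ Finset.range k, g i).1 t = ∑ i ∈ Finset.range k, (g i).1 t := by
      simp
    have h2 := (hsum t).sum_add_tsum_nat_add k
    have hk := (summable_nat_add_iff k).2 ha
    change |∑' i, (g i).1 t - _| ≤ _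
    rw [h1, ← h2, add_sub_cancel_left, ← tsum_mul_right]
    exact tsum_of_norm_bounded (hk.mul_right ‖t‖).hasSum fun i =>
      (Real.norm_eq_abs _).trans_le (hg (i + k) t)

namespace VectorLatticeHom

section Basic

variable {E F : Type*} [AddCommGroup E] [Lattice E] [Module ℝ E] [AddCommGroup F] [Lattice F]
  [Module ℝ F] (Φ : VectorLatticeHom E F)

theorem map_sub (f g : E) : Φ (f - g) = Φ f - Φ g := Φ.toLinearMap.map_sub f g

theorem map_neg (f : E) : Φ (-f) = -Φ f := Φ.toLinearMap.map_neg f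

theorem mono {f g : E} (h : f ≤ g) : Φ f ≤ Φ g := by
  have := Φ.map_sup' f g
  rw [sup_eq_right.2 h] at this
  rw [this]
  exact le_sup_left

theorem map_normFun [NeZero n] (Φ : VectorLatticeHom (H n) F) {x : Fin n → F}
    (hΦ : ∀ i, Φ (proj i) = x i) :
    Φ (normFun n) = supAbs x := by
  have h := map_finset_sup' Φ.toLatticeHom (Finset.univ_nonempty (α := Fin n))
    (fun i => |(proj i : H n)|)
  rw [normFun_eq_supAbs]
  refine h.trans (Finset.sup'_congr _ rfl fun i _ => ?_)
  change Φ (proj i ⊔ -proj i) = x i ⊔ -x i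
  rw [← hΦ i, ← Φ.map_neg]
  exact Φ.map_sup' _ _

theorem map_smul_normFun [NeZero n] (Φ : VectorLatticeHom (H n) F) {x : Fin n → F}
    (hΦ : ∀ i, Φ (proj i) = x i) (r : ℝ) : Φ (r • normFun n) = r • supAbs x := by
  rw [← map_normFun Φ hΦ]
  exact Φ.toLinearMap.map_smul r _

theorem abs_map_le [NeZero n] (Φ : VectorLatticeHom (H n) F) {x : Fin n → F}
    (hΦ : ∀ i, Φ (proj i) = x i) {f : H n} {r : ℝ}
    (h : ∀ t, |f.1 t| ≤ r * ‖t‖) : |Φ f| ≤ r • supAbs x := by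
  rw [← map_smul_normFun Φ hΦ]
  refine abs_le'.2 ⟨Φ.mono fun t => (le_abs_self _).trans (h t), ?_⟩
  rw [← Φ.map_neg]
  exact Φ.mono fun t => (neg_le_abs _).trans (h t)

/-- Truncation at `± r ‖t‖`: the norm of the order ideal is the quotient norm on the range. -/
theorem exists_lift_abs_le [IsOrderedAddMonoid F] [NeZero n] (Φ : VectorLatticeHom (H n) F)
    {x : Fin n → F} (hΦ : ∀ i, Φ (proj i) = x i) {f : H n} {r : ℝ}
    (hr : 0 ≤ r) (h : |Φ f| ≤ r • supAbs x) : ∃ g : H n, Φ g = Φ f ∧ ∀ t, |g.1 t| ≤ r * ‖t‖ := by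
  refine ⟨(f ⊓ r • normFun n) ⊔ -(r • normFun n), ?_, fun t => ?_⟩
  · have h2 := Φ.map_sup' (f ⊓ r • normFun n) (-(r • normFun n))
    have h3 := Φ.map_inf' f (r • normFun n)
    rw [h2, h3, Φ.map_neg, map_smul_normFun Φ hΦ, inf_eq_left.2 ((le_abs_self _).trans h),
      sup_eq_left]
    exact neg_le.1 ((neg_le_abs _).trans h)
  · change |max (min (f.1 t) (r * ‖t‖)) (-(r * ‖t‖))| ≤ _
    have := mul_nonneg hr (norm_nonneg t)
    exact abs_le.2 ⟨le_max_right _ _, max_le (min_le_right _ _) (by linarith)⟩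

end Basic

variable (Φ : VectorLatticeHom (H n) X)

/-- The part of the range of a homomorphism that lies in the ideal generated by `e`. -/
def rangeIn (e : X) : Submodule ℝ (orderIdeal e) :=
  (LinearMap.range Φ.toLinearMap).comap (orderIdeal e).subtype

theorem isSublattice_rangeIn (e : X) : IsSublattice (Φ.rangeIn e : Set (orderIdeal e)) := by
  constructor
  · rintro a ⟨f, hf⟩ b ⟨g, hg⟩
    exact ⟨f ⊔ g, (Φ.map_sup' f g).trans (congrArg₂ _ hf hg)⟩
  · rintro a ⟨f, hf⟩ b ⟨g, hg⟩
    exact ⟨f ⊓ g, (Φ.map_inf' f g).trans (congrArg₂ _ hf hg)⟩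

variable [NeZero n]

/-- Two homomorphisms with the same values at the projections agree on a dense sublattice. -/
theorem eq_of_proj (hX : IsArchimedean X) {Φ Ψ : VectorLatticeHom (H n) X} {x : Fin n → X}
    (hΦ : ∀ i, Φ (proj i) = x i) (hΨ : ∀ i, Ψ (proj i) = x i) : Φ = Ψ := by
  have key : ∀ f : H n, Φ f = Ψ f := by
    intro f
    let S : Submodule ℝ (H n) := LinearMap.eqLocus Φ.toLinearMap Ψ.toLinearMap
    have hS : IsSublattice (S : Set (H n)) := by
      constructor
      · intro a ha b hb
        exact (Φ.map_sup' a b).trans ((congrArg₂ _ ha hb).trans (Ψ.map_sup' a b).symm)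
      · intro a ha b hb
        exact (Φ.map_inf' a b).trans ((congrArg₂ _ ha hb).trans (Ψ.map_inf' a b).symm)
    have h0 : |Φ f - Ψ f| ≤ (0 : ℝ) • supAbs x := by
      refine hX.le_smul_of_forall_pos (supAbs_nonneg x) fun ε hε => ?_
      obtain ⟨g, hg, hfg⟩ := exists_mem_abs_sub_le hS (fun i => (hΦ i).trans (hΨ i).symm) f
        (half_pos hε)
      have hg' : Φ g = Ψ g := hg
      have h1 : Φ f - Ψ f = Φ (f - g) - Ψ (f - g) := by
        rw [map_sub, map_sub, hg', sub_sub_sub_cancel_right]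
      rw [h1, zero_add, ← add_halves ε, add_smul, sub_eq_add_neg]
      refine (abs_add_le _ _).trans (add_le_add (abs_map_le Φ hΦ hfg) ?_)
      rw [abs_neg]
      exact abs_map_le Ψ hΨ hfg
    rw [zero_smul] at h0
    have h1 := (le_abs_self _).trans h0
    have h2 := (neg_le_abs _).trans h0
    exact le_antisymm (sub_nonpos.1 h1) (sub_nonneg.1 (neg_nonpos.1 h2))
  obtain ⟨⟨⟨a, _⟩, _⟩, _, _⟩ := Φ
  obtain ⟨⟨⟨b, _⟩, _⟩, _, _⟩ := Ψ
  obtain rfl : a = b := funext key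
  rfl

/-- Preimages of the terms of an absolutely convergent series in the range may be chosen with the
same norms, so that they sum to a preimage of the limit. -/
theorem isComplete_rangeIn (hX : IsArchimedean X) {x : Fin n → X} (hΦ : ∀ i, Φ (proj i) = x i) :
    IsComplete (Φ.rangeIn (supAbs x) : Set (orderIdeal (supAbs x))) := by
  have he := supAbs_nonneg x
  -- `‖·‖_e` is a norm on the range, so completeness may be tested on absolutely convergent series.
  let _ : NormedAddCommGroup (Φ.rangeIn (supAbs x)) :=
    NormedAddCommGroup.ofSeparation fun y hy =>
      Subtype.ext (eq_zero_of_norm_orderIdeal hX y.1 hy)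
  rw [← completeSpace_coe_iff_isComplete]
  refine NormedAddCommGroup.completeSpace_of_summable_imp_tendsto fun u hu => ?_
  have hlift : ∀ i, ∃ g : H n, Φ g = ((u i : orderIdeal (supAbs x)) : X) ∧
      ∀ t, |g.1 t| ≤ ‖u i‖ * ‖t‖ := by
    intro i
    obtain ⟨f, hf⟩ := (u i).2
    have hf' : Φ f = ((u i : orderIdeal (supAbs x)) : X) := hf
    have h := (norm_le_iff hX he (u i).1 (norm_nonneg _)).1 le_rfl
    rw [← hf'] at h ⊢
    exact Φ.exists_lift_abs_le hΦ (norm_nonneg _) h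
  choose g hg hgu using hlift
  obtain ⟨f, hf⟩ := H.exists_sum g hu (fun i => norm_nonneg _) hgu
  have hmem : Φ f ∈ orderIdeal (supAbs x) :=
    ⟨∑' i, ‖u i‖, tsum_nonneg fun i => norm_nonneg _, Φ.abs_map_le hΦ fun t => by
      simpa using hf 0 t⟩
  refine ⟨⟨⟨Φ f, hmem⟩, f, rfl⟩, ?_⟩
  rw [tendsto_iff_norm_sub_tendsto_zero]
  refine squeeze_zero (fun k => norm_nonneg _) (fun k => ?_)
    (tendsto_sum_nat_add fun i => ‖u i‖)
  rw [norm_sub_rev]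
  refine (norm_le_iff hX he _ (tsum_nonneg fun i => norm_nonneg _)).2 ?_
  have h := Φ.abs_map_le hΦ (f := f - ∑ i ∈ Finset.range k, g i) (hf k)
  rw [map_sub] at h
  have hs : Φ (∑ i ∈ Finset.range k, g i) =
      (((∑ i ∈ Finset.range k, u i : Φ.rangeIn (supAbs x)) : orderIdeal (supAbs x)) : X) := by
    refine (_root_.map_sum Φ.toLinearMap g _).trans ?_
    rw [AddSubmonoidClass.coe_finsetSum, AddSubmonoidClass.coe_finsetSum]
    exact Finset.sum_congr rfl fun i _ => hg i
  rw [hs] at h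
  exact h

/-- The closed sublattice generated by `x` is a closed subset of the complete range. -/
theorem isCompleteOnGenerated (hX : IsArchimedean X) {x : Fin n → X}
    (hΦ : ∀ i, Φ (proj i) = x i) : IsCompleteOnGenerated x (supAbs x) le_rfl := by
  have hc := Φ.isComplete_rangeIn hX hΦ
  let _ : NormedAddCommGroup (orderIdeal (supAbs x)) :=
    NormedAddCommGroup.ofSeparation (eq_zero_of_norm_orderIdeal hX)
  have hle := closedSublatticeSpan_le (Φ.isSublattice_rangeIn (supAbs x)) hc.isClosed
    (s := Set.range (tupleIn x (supAbs x) le_rfl)) (by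
      rintro _ ⟨i, rfl⟩
      exact ⟨proj i, hΦ i⟩)
  intro F hF hFS
  obtain ⟨y, -, hy⟩ := hc F hF (hFS.trans (principal_mono.2 hle))
  have := hF.1
  exact ⟨y, (isClosed_closedSublatticeSpan _).mem_of_tendsto (f := id) hy
    (hFS (mem_principal_self _)), hy⟩

end VectorLatticeHom

end Completeness

end VL

theorem proposition2p2 {X : Type*} [AddCommGroup X] [Lattice X] [IsOrderedAddMonoid X]
    [Module ℝ X] [IsOrderedModule ℝ X] (hX : VL.IsArchimedean X)
    (n : ℕ) [NeZero n] (x : Fin n → X) :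
    List.TFAE
      [∃ Φ : VL.VectorLatticeHom (VL.H n) X, ∀ i, Φ (VL.proj i) = x i,
       VL.IsCompleteOnGenerated x (VL.supAbs x) le_rfl,
       ∃ (e : X) (he : VL.supAbs x ≤ e), 0 ≤ e ∧ VL.IsCompleteOnGenerated x e he] ∧
    (∀ Φ Ψ : VL.VectorLatticeHom (VL.H n) X,
      (∀ i, Φ (VL.proj i) = x i) → (∀ i, Ψ (VL.proj i) = x i) → Φ = Ψ) := by
  refine ⟨?_, fun Φ Ψ hΦ hΨ => VL.VectorLatticeHom.eq_of_proj hX hΦ hΨ⟩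
  tfae_have 1 → 2
  | ⟨Φ, hΦ⟩ => Φ.isCompleteOnGenerated hX hΦ
  tfae_have 2 → 3
  | h => ⟨VL.supAbs x, le_rfl, VL.supAbs_nonneg x, h⟩
  tfae_have 3 → 1
  | ⟨_, _, _, h⟩ => VL.exists_hom_of_isCompleteOnGenerated hX h
  tfae_finish
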